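/- Let $X=(X_n:n\ge 0)$ be an irreducible, positive recurrent Markov chain on $S=\mathbb{Z}_+=\{0,1,2,\dots\}$ with one-step transition matrix $P$ and stationary distribution $\pi$. Write $P_x$ and $E_x$ for probability and expectation when $X_0=x$. Suppose that $X$ is stochastically monotone, i.e. for each $y\in S$ the probability $P_x(X_1>y)$ is non-decreasing in $x\in S$. Let $r:S\to\mathbb{R}$ be non-decreasing and $\pi$-integrable, put $\pi r=\sum_{y}r(y)\pi(y)$ and $r_c(x)=r(x)-\pi r$, and let $\tau=\inf\{n\ge 1: X_n=0\}$. Then for every $x\in S$, $\tau<\infty$ $P_x$-a.s. and $\sum_{j=0}^{\tau-1}r_c(X_j)$ is $P_x$-integrable, and the function $$g_0(x)=E_x\sum_{j=0}^{\tau-1}r_c(X_j),\qquad x\in S,$$ is non-decreasing and solves Poisson's equation $(P-I)g_0=-r_c$, i.e. for every $x\in S$, $\sum_y P(x,y)|g_0(y)|<\infty$ and $\sum_y P(x,y)g_0(y)-g_0(x)=-r_c(x)$. Moreover, for every $x\in S$, the sequence $$M_n=g_0(X_n)+\sum_{j=0}^{n-1}r_c(X_j),\qquad n\ge 0,$$ is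 a $P_x$-martingale with respect to the filtration $\mathcal{F}_n=\sigma(X_j:j\le n)$. -/

import Mathlib

open MeasureTheory ProbabilityTheory
open scoped ENNReal

noncomputable section

namespace MonotoneChain

variable {Ω : Type*} [MeasurableSpace Ω]

/-- `X` is a Markov chain on `ℕ` with one-step transition kernel `P`, where `Pr x` is the law under
which the chain starts in state `x`. -/
structure IsMarkovFamily (P : Kernel ℕ ℕ) (Pr : ℕ → Measure Ω) (X : ℕ → Ω → ℕ) : Prop where
  measurable : ∀ n, Measurable (X n)
  isProbabilityMeasure : ∀ x, IsProbabilityMeasure (Pr x)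
  /-- `X 0 = x` almost surely under `Pr x`. -/
  initial : ∀ x, ∀ᵐ ω ∂(Pr x), X 0 ω = x
  /-- The Markov property: given `X 0 = a 0, …, X n = a n`, the next state has law `P (a n)`. -/
  markov : ∀ (x n : ℕ) (a : ℕ → ℕ) (b : ℕ),
    Pr x {ω | (∀ i ≤ n, X i ω = a i) ∧ X (n + 1) ω = b} =
      Pr x {ω | ∀ i ≤ n, X i ω = a i} * P (a n) {b}

/-- `P_x(X_1 > y)` is non-decreasing in `x`, for each `y`. -/
def StochasticallyMonotone (P : Kernel ℕ ℕ) : Prop :=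
  ∀ y : ℕ, Monotone fun x : ℕ => P x (Set.Ioi y)

/-- The first return time `inf {n ≥ 1 : X n = z}`, equal to `⊤` if there is no such `n`. -/
def returnTime (X : ℕ → Ω → ℕ) (z : ℕ) : Ω → ℕ∞ :=
  hittingAfter X {z} 1

/-- Every state has a finite mean return time. -/
def PositiveRecurrent (Pr : ℕ → Measure Ω) (X : ℕ → Ω → ℕ) : Prop :=
  ∀ z : ℕ, ∫⁻ ω, ((returnTime X z ω : ℕ∞) : ℝ≥0∞) ∂(Pr z) < ⊤

/-- The centered reward `r_c = r - π r`. -/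
def centered (π : Measure ℕ) (r : ℕ → ℝ) (x : ℕ) : ℝ :=
  r x - ∫ y, r y ∂π

open scoped Classical in
/-- The random sum `∑_{j < τ} f (X j)`, with `τ` the first return time to `0`. -/
def cycleSum (X : ℕ → Ω → ℕ) (f : ℕ → ℝ) (ω : Ω) : ℝ :=
  ∑' j : ℕ, if (j : ℕ∞) < returnTime X 0 ω then f (X j ω) else 0

/-- `g₀ x = E_x ∑_{j < τ} r_c (X j)`, with `τ` the first return time to `0`. -/
def g₀ (Pr : ℕ → Measure Ω) (X : ℕ → Ω → ℕ) (π : Measure ℕ) (r : ℕ → ℝ) (x : ℕ) : ℝ :=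
  ∫ ω, cycleSum X (centered π r) ω ∂(Pr x)

/-- `g` solves Poisson's equation `(P - I) g = -f`; in particular `P g` is well defined. -/
def SolvesPoisson (P : Kernel ℕ ℕ) (f g : ℕ → ℝ) : Prop :=
  ∀ x : ℕ, Integrable g (P x) ∧ (∫ y, g y ∂(P x)) - g x = -f x

/-- The filtration `ℱ n = σ(X j : j ≤ n)`. -/
def chainFiltration (X : ℕ → Ω → ℕ) (hX : ∀ n, Measurable (X n)) :
    Filtration ℕ (inferInstance : MeasurableSpace Ω) :=
  Filtration.natural X fun n => (hX n).stronglyMeasurable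

end MonotoneChain

end

/-! Let `Q = killed P` be `P` with the transitions into `0` removed, and `G = ∑ Q ^ n` its Green
kernel. On `{n < τ}` the law of `X n` is `Q ^ n`, so `g₀ x` is the integral of `f = r_c` against `G
x`, and the claims become statements about kernels.

The mass of `G 0` is at most the mean return time, hence finite. Then `π {0} • G 0 = π`
(`smul_green_zero_eq`), so `g₀ 0 = 0` because `f` has mean zero, and `G x` is dominated by a
multiple of `π` (`exists_green_le`), so `g₀` is well defined. A first-step decomposition gives `g₀ =
f + Q g₀`, and `Q g₀ = P g₀` since `g₀ 0 = 0`: this is Poisson's equation, and the martingale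
property follows from it.

Monotonicity is hidden in the cycle formula, since `τ` depends on the starting point. The discounted
potential `u_a = ∑ a ^ n P ^ n f` is monotone, because `P` preserves monotone functions. As `u_a -
u_a 0` vanishes at `0`, it equals `∑ a ^ j Q ^ j (f - (1 - a) u_a 0)`. At the state `0` this
identity writes `(1 - a) u_a 0` as a quotient tending to `G 0 f / G 0 1 = 0`, so by Abel's theorem
`u_a - u_a 0` tends to `g₀` as `a ↑ 1` (`tendsto_potential_sub`). -/

noncomputable section

namespace MonotoneChain

/-! ### Kernels on `ℕ`: integration against powers. -/

section Kernels

variable {P : Kernel ℕ ℕ} {π : Measure ℕ}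

theorem lintegral_pow_succ (κ : Kernel ℕ ℕ) (n x : ℕ) (f : ℕ → ℝ≥0∞) :
    ∫⁻ y, f y ∂(κ ^ (n + 1)) x = ∫⁻ y, ∫⁻ z, f z ∂κ y ∂(κ ^ n) x := by
  rw [pow_succ']
  exact Kernel.lintegral_comp _ _ _ .of_discrete

theorem lintegral_pow_succ' (κ : Kernel ℕ ℕ) (n x : ℕ) (f : ℕ → ℝ≥0∞) :
    ∫⁻ y, f y ∂(κ ^ (n + 1)) x = ∫⁻ y, ∫⁻ z, f z ∂(κ ^ n) y ∂κ x := by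
  rw [pow_succ]
  exact Kernel.lintegral_comp _ _ _ .of_discrete

theorem lintegral_pow_add (κ : Kernel ℕ ℕ) (m n x : ℕ) (f : ℕ → ℝ≥0∞) :
    ∫⁻ y, f y ∂(κ ^ (m + n)) x = ∫⁻ y, ∫⁻ z, f z ∂(κ ^ n) y ∂(κ ^ m) x := by
  rw [add_comm, pow_add]
  exact Kernel.lintegral_comp _ _ _ .of_discrete

theorem lintegral_pow_zero (κ : Kernel ℕ ℕ) (x : ℕ) (f : ℕ → ℝ≥0∞) :
    ∫⁻ y, f y ∂(κ ^ 0) x = f x := by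
  rw [pow_zero]
  change ∫⁻ y, f y ∂(Kernel.id x) = f x
  simp [Kernel.id_apply]

instance isMarkovKernel_pow (κ : Kernel ℕ ℕ) [IsMarkovKernel κ] (n : ℕ) :
    IsMarkovKernel (κ ^ n) := by
  induction n with
  | zero => exact inferInstanceAs (IsMarkovKernel Kernel.id)
  | succ n ih => rw [pow_succ]; exact inferInstanceAs (IsMarkovKernel ((κ ^ n) ∘ₖ κ))

theorem measure_le_of_lintegral_le {μ ν : Measure ℕ}
    (h : ∀ f : ℕ → ℝ≥0∞, ∫⁻ y, f y ∂μ ≤ ∫⁻ y, f y ∂ν) : μ ≤ ν := by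
  refine Measure.le_iff.2 fun s hs => ?_
  simpa [lintegral_indicator hs] using h (s.indicator 1)

theorem apply_le_lintegral (μ : Measure ℕ) (f : ℕ → ℝ≥0∞) (x : ℕ) :
    f x * μ {x} ≤ ∫⁻ y, f y ∂μ := by
  rw [lintegral_countable']
  exact ENNReal.le_tsum x

/-! ### Powers of a kernel with an invariant law -/

theorem invariant_pow (h : Kernel.Invariant P π) (n : ℕ) : Kernel.Invariant (P ^ n) π := by
  induction n with
  | zero =>
    rw [pow_zero]
    change π.bind Kernel.id = π
    simp
  | succ n ih => rw [pow_succ]; exact Kernel.Invariant.comp ih h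

theorem lintegral_invariant (h : Kernel.Invariant P π) (n : ℕ) (f : ℕ → ℝ≥0∞) :
    ∫⁻ x, ∫⁻ y, f y ∂(P ^ n) x ∂π = ∫⁻ y, f y ∂π := by
  conv_rhs => rw [← (invariant_pow h n).def]
  rw [Measure.lintegral_bind (Kernel.aemeasurable _) (Measurable.of_discrete.aemeasurable)]

theorem exists_pow_apply_pos (hirr : Kernel.IsIrreducible Measure.count P) (x y : ℕ) :
    ∃ n, 0 < (P ^ n) x {y} :=
  hirr.irreducible (measurableSet_singleton y) (by simp) x

/-- Some state carries mass; irreducibility sends part of it to `x`, and invariance keeps it there.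
-/
theorem invariant_singleton_pos (hirr : Kernel.IsIrreducible Measure.count P)
    [IsProbabilityMeasure π] (h : Kernel.Invariant P π) (x : ℕ) : 0 < π {x} := by
  have h1 : ∃ y, π {y} ≠ 0 := by
    by_contra! h0
    have := (measure_univ (μ := π))
    rw [← Set.iUnion_of_singleton, measure_iUnion_null h0] at this
    exact zero_ne_one this
  obtain ⟨y, hy⟩ := h1
  obtain ⟨n, hn⟩ := exists_pow_apply_pos hirr y x
  have h2 := lintegral_invariant h n (Set.indicator {x} 1)
  have h3 := apply_le_lintegral π (fun z => ∫⁻ w, Set.indicator {x} 1 w ∂(P ^ n) z) y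
  rw [h2] at h3
  simp only [lintegral_indicator_one (measurableSet_singleton x)] at h3
  exact (ENNReal.mul_pos hn.ne' hy).trans_le h3

/-- A point mass at `x` is at most `π / π {x}`, and `P ^ n` preserves `π`; the constant is uniform
in `n`. -/
theorem lintegral_pow_le (hpos : ∀ x, 0 < π {x}) [IsProbabilityMeasure π]
    (h : Kernel.Invariant P π) (n x : ℕ) (f : ℕ → ℝ≥0∞) :
    ∫⁻ y, f y ∂(P ^ n) x ≤ (π {x})⁻¹ * ∫⁻ y, f y ∂π := by
  have h3 := apply_le_lintegral π (fun z => ∫⁻ w, f w ∂(P ^ n) z) x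
  rw [lintegral_invariant h] at h3
  rw [mul_comm, ← div_eq_mul_inv]
  exact ENNReal.le_div_iff_mul_le (.inl (hpos x).ne') (.inl (measure_ne_top _ _)) |>.2 h3

theorem pow_apply_le (hpos : ∀ x, 0 < π {x}) [IsProbabilityMeasure π]
    (h : Kernel.Invariant P π) (n x : ℕ) : (P ^ n) x ≤ (π {x})⁻¹ • π :=
  measure_le_of_lintegral_le fun f => by
    rw [lintegral_smul_measure]; exact lintegral_pow_le hpos h n x f

theorem integrable_pow (hpos : ∀ x, 0 < π {x}) [IsProbabilityMeasure π]
    (h : Kernel.Invariant P π) {f : ℕ → ℝ} (hf : Integrable f π) (n x : ℕ) :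
    Integrable f ((P ^ n) x) :=
  hf.of_measure_le_smul (ENNReal.inv_ne_top.2 (hpos x).ne') (pow_apply_le hpos h n x)

/-! ### The chain killed on entering `0` and its Green kernel -/

/-- The substochastic kernel of the chain killed when it enters `0`. -/
def killed (P : Kernel ℕ ℕ) : Kernel ℕ ℕ :=
  P.restrict (s := {0}ᶜ) (measurableSet_singleton 0).compl

/-- The expected number of visits strictly before the return to `0`. -/
def green (P : Kernel ℕ ℕ) : Kernel ℕ ℕ :=
  Kernel.sum fun n => killed P ^ n

theorem killed_apply (P : Kernel ℕ ℕ) (x : ℕ) : killed P x = (P x).restrict {0}ᶜ := rfl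

theorem lintegral_killed (P : Kernel ℕ ℕ) (x : ℕ) (f : ℕ → ℝ≥0∞) :
    ∫⁻ y, f y ∂P x = ∫⁻ y, f y ∂killed P x + P x {0} * f 0 := by
  rw [killed_apply, ← lintegral_add_compl f (measurableSet_singleton 0), add_comm,
    lintegral_singleton, mul_comm]

theorem killed_le (P : Kernel ℕ ℕ) (x : ℕ) : killed P x ≤ P x := Measure.restrict_le_self

theorem killed_pow_le (P : Kernel ℕ ℕ) (n x : ℕ) : (killed P ^ n) x ≤ (P ^ n) x := by
  refine measure_le_of_lintegral_le fun f => ?_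
  induction n generalizing x f with
  | zero => rw [lintegral_pow_zero, lintegral_pow_zero]
  | succ n ih =>
    rw [lintegral_pow_succ, lintegral_pow_succ]
    exact (ih x _).trans (lintegral_mono fun y => lintegral_mono' (killed_le P y) le_rfl)

theorem green_apply (P : Kernel ℕ ℕ) (x : ℕ) :
    green P x = Measure.sum fun n => (killed P ^ n) x := Kernel.sum_apply _ _

theorem lintegral_green (P : Kernel ℕ ℕ) (x : ℕ) (f : ℕ → ℝ≥0∞) :
    ∫⁻ y, f y ∂green P x = ∑' n, ∫⁻ y, f y ∂(killed P ^ n) x := by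
  rw [green_apply, lintegral_sum_measure]

/-- Split off time `0`, then condition on the first step; `lintegral_green_right` conditions on the
last one. -/
theorem lintegral_green_left (P : Kernel ℕ ℕ) (x : ℕ) (f : ℕ → ℝ≥0∞) :
    ∫⁻ y, f y ∂green P x = f x + ∫⁻ y, ∫⁻ z, f z ∂green P y ∂killed P x := by
  simp_rw [lintegral_green]
  rw [tsum_eq_zero_add' ENNReal.summable, lintegral_pow_zero,
    lintegral_tsum fun _ => Measurable.of_discrete.aemeasurable]
  simp_rw [lintegral_pow_succ']

theorem lintegral_green_right (P : Kernel ℕ ℕ) (x : ℕ) (f : ℕ → ℝ≥0∞) :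
    ∫⁻ y, f y ∂green P x = f x + ∫⁻ y, ∫⁻ z, f z ∂killed P y ∂green P x := by
  simp_rw [lintegral_green]
  rw [tsum_eq_zero_add' ENNReal.summable, lintegral_pow_zero]
  simp_rw [lintegral_pow_succ]

theorem green_eq (P : Kernel ℕ ℕ) (x : ℕ) :
    green P x = Measure.dirac x + (green P ∘ₖ killed P) x := by
  have key : ∀ f : ℕ → ℝ≥0∞, ∫⁻ y, f y ∂green P x =
      ∫⁻ y, f y ∂(Measure.dirac x + (green P ∘ₖ killed P) x) := fun f => by
    rw [lintegral_green_left, lintegral_add_measure, lintegral_dirac,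
      Kernel.lintegral_comp _ _ _ .of_discrete]
  exact le_antisymm (measure_le_of_lintegral_le fun f => (key f).le)
    (measure_le_of_lintegral_le fun f => (key f).ge)

/-! ### The cycle formula for the invariant law -/

theorem lintegral_invariant_split (h : Kernel.Invariant P π) (f : ℕ → ℝ≥0∞) :
    ∫⁻ x, f x ∂π = π {0} * f 0 + ∫⁻ x, ∫⁻ y, f y ∂killed P x ∂π := by
  have key : ∀ x, ∫⁻ y, f y ∂killed P x = ∫⁻ y, ({0}ᶜ : Set ℕ).indicator f y ∂P x := fun x => by
    rw [killed_apply, lintegral_indicator (measurableSet_singleton 0).compl]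
  have h1 := lintegral_invariant h 1 (({0}ᶜ : Set ℕ).indicator f)
  rw [pow_one, lintegral_indicator (measurableSet_singleton 0).compl] at h1
  simp_rw [key]
  rw [h1, ← lintegral_add_compl f (measurableSet_singleton 0), lintegral_singleton, mul_comm]

/-- Decomposition of a stationary path at its last visit to `0` among the latest `n` times; the
remainder is the case of no visit. -/
theorem lintegral_invariant_eq_sum (h : Kernel.Invariant P π) (n : ℕ) (f : ℕ → ℝ≥0∞) :
    ∫⁻ x, f x ∂π = π {0} * ∑ j ∈ Finset.range n, ∫⁻ y, f y ∂(killed P ^ j) 0 +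
      ∫⁻ x, ∫⁻ y, f y ∂(killed P ^ n) x ∂π := by
  induction n with
  | zero => simp_rw [lintegral_pow_zero]; simp
  | succ n ih =>
    rw [ih, lintegral_invariant_split h (fun x => ∫⁻ y, f y ∂(killed P ^ n) x),
      Finset.sum_range_succ, mul_add, add_assoc]
    simp_rw [← lintegral_pow_succ']

theorem smul_green_zero_le (h : Kernel.Invariant P π) : π {0} • green P 0 ≤ π := by
  refine measure_le_of_lintegral_le fun f => ?_
  rw [lintegral_smul_measure, lintegral_green, smul_eq_mul, ← ENNReal.tsum_mul_left]
  refine ENNReal.tsum_le_of_sum_range_le fun n => ?_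
  rw [← Finset.mul_sum, lintegral_invariant_eq_sum h n f]
  exact le_self_add

/-- Mass balance: one step of `P` splits the mass of `green P 0` into a surviving part, which is all
but the initial unit, and the part entering `0`. Finiteness permits cancelling. -/
theorem lintegral_green_return [IsMarkovKernel P] (hG : green P 0 Set.univ ≠ ∞) :
    ∫⁻ y, P y {0} ∂green P 0 = 1 := by
  have h1 := lintegral_green_right P 0 1
  have h2 : green P 0 Set.univ = ∫⁻ y, killed P y Set.univ ∂green P 0 +
      ∫⁻ y, P y {0} ∂green P 0 := by
    rw [← lintegral_add_left .of_discrete]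
    have : ∀ y, killed P y Set.univ + P y {0} = 1 := fun y => by
      simpa using (lintegral_killed P y 1).symm
    simp [this]
  simp only [Pi.one_apply, lintegral_one] at h1
  rw [h1, add_comm] at h2
  refine ((ENNReal.add_right_inj ?_).1 h2).symm
  exact ne_top_of_le_ne_top hG (h1 ▸ le_add_self)

/-- The unit mass returning to `0` replaces the initial unit mass at `0`. -/
theorem invariant_green_zero [IsMarkovKernel P] (hG : green P 0 Set.univ ≠ ∞) :
    Kernel.Invariant P (green P 0) := by
  have key : ∀ f : ℕ → ℝ≥0∞, ∫⁻ y, f y ∂(green P 0).bind P = ∫⁻ y, f y ∂green P 0 := fun f => by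
    rw [Measure.lintegral_bind (Kernel.aemeasurable _) (Measurable.of_discrete.aemeasurable)]
    simp_rw [lintegral_killed P]
    rw [lintegral_add_left .of_discrete, lintegral_mul_const _ .of_discrete,
      lintegral_green_return hG, one_mul, add_comm, ← lintegral_green_right]
  exact le_antisymm (measure_le_of_lintegral_le fun f => (key f).le)
    (measure_le_of_lintegral_le fun f => (key f).ge)

theorem killed_pow_succ_apply_zero (P : Kernel ℕ ℕ) (n x : ℕ) :
    (killed P ^ (n + 1)) x {0} = 0 := by
  rw [Kernel.pow_succ_apply_eq_lintegral _ _ _ (measurableSet_singleton 0)]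
  simp [killed_apply]

theorem green_zero_apply_zero (P : Kernel ℕ ℕ) : green P 0 {0} = 1 := by
  rw [green_apply, Measure.sum_apply _ (measurableSet_singleton 0),
    tsum_eq_zero_add' ENNReal.summable]
  simp only [killed_pow_succ_apply_zero, tsum_zero, add_zero]
  rw [pow_zero]
  change Kernel.id 0 {0} = 1
  simp [Kernel.id_apply]

/-- Both sides are invariant, comparable, and agree at `0`. A deficit at `y` would be carried to `0`
by some `P ^ n`, where there is none. -/
theorem smul_green_zero_eq [IsMarkovKernel P] [IsProbabilityMeasure π]
    (hirr : Kernel.IsIrreducible Measure.count P)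
    (h : Kernel.Invariant P π) (hG : green P 0 Set.univ ≠ ∞) : π {0} • green P 0 = π := by
  have hle := smul_green_zero_le h
  refine Measure.ext_of_singleton fun y => ?_
  by_contra hne
  have hlt : (π {0} • green P 0) {y} < π {y} := lt_of_le_of_ne (hle _) hne
  obtain ⟨n, hn⟩ := exists_pow_apply_pos hirr y 0
  have e1 := lintegral_invariant h n (Set.indicator {0} 1)
  have e2 := lintegral_invariant (invariant_green_zero hG) n (Set.indicator {0} 1)
  simp only [lintegral_indicator_one (measurableSet_singleton 0)] at e1 e2
  have : ∫⁻ x, (P ^ n) x {0} ∂(π {0} • green P 0) < ∫⁻ x, (P ^ n) x {0} ∂π := by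
    rw [lintegral_countable', lintegral_countable']
    refine ENNReal.tsum_lt_tsum (i := y) ?_ (fun x => by gcongr) ?_
    · rw [← lintegral_countable', lintegral_smul_measure, e2, green_zero_apply_zero]
      simp
    · exact ENNReal.mul_lt_mul_right hn.ne' (measure_ne_top _ _) hlt
  rw [lintegral_smul_measure, e1, e2, green_zero_apply_zero] at this
  simp at this

theorem exists_killed_pow_pos [IsMarkovKernel P] [IsProbabilityMeasure π]
    (hirr : Kernel.IsIrreducible Measure.count P)
    (h : Kernel.Invariant P π) (hG : green P 0 Set.univ ≠ ∞) (x : ℕ) :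
    ∃ n, (killed P ^ n) 0 {x} ≠ 0 := by
  by_contra! h0
  have : (π {0} • green P 0) {x} = 0 := by
    rw [green_apply, Measure.smul_apply, Measure.sum_apply _ (measurableSet_singleton x)]
    simp [h0]
  rw [smul_green_zero_eq hirr h hG] at this
  exact (invariant_singleton_pos hirr h x).ne' this

/-- An excursion from `0` reaches `x` at some time `n` with positive probability, and its visits
after that are already counted in `green P 0 = π / π {0}`. -/
theorem exists_green_le [IsMarkovKernel P] [IsProbabilityMeasure π]
    (hirr : Kernel.IsIrreducible Measure.count P)
    (h : Kernel.Invariant P π) (hG : green P 0 Set.univ ≠ ∞) (x : ℕ) :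
    ∃ c : ℝ≥0∞, c ≠ ∞ ∧ green P x ≤ c • π := by
  obtain ⟨n, hn⟩ := exists_killed_pow_pos hirr h hG x
  have hpos := invariant_singleton_pos hirr h 0
  have hfin : (killed P ^ n) 0 {x} ≠ ∞ :=
    ne_top_of_le_ne_top (measure_ne_top _ _) (killed_pow_le P n 0 {x})
  refine ⟨((killed P ^ n) 0 {x})⁻¹ * (π {0})⁻¹,
    ENNReal.mul_ne_top (ENNReal.inv_ne_top.2 hn) (ENNReal.inv_ne_top.2 hpos.ne'),
    measure_le_of_lintegral_le fun f => ?_⟩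
  have h1 : (∫⁻ y, f y ∂green P x) * (killed P ^ n) 0 {x} ≤ ∫⁻ y, f y ∂green P 0 := by
    refine (apply_le_lintegral ((killed P ^ n) 0) (fun x => ∫⁻ y, f y ∂green P x) x).trans ?_
    simp_rw [lintegral_green]
    rw [lintegral_tsum fun _ => Measurable.of_discrete.aemeasurable]
    simp_rw [← lintegral_pow_add]
    exact ENNReal.tsum_comp_le_tsum_of_injective (add_right_injective n)
      fun k => ∫⁻ y, f y ∂(killed P ^ k) 0
  rw [lintegral_smul_measure, smul_eq_mul, mul_assoc]
  conv_rhs => rw [← smul_green_zero_eq hirr h hG]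
  rw [lintegral_smul_measure, smul_eq_mul, Measure.smul_apply, green_zero_apply_zero, smul_eq_mul,
    mul_one, ENNReal.inv_mul_cancel_left hpos.ne' (measure_ne_top _ _), mul_comm,
    ← div_eq_mul_inv]
  exact ENNReal.le_div_iff_mul_le (.inl hn) (.inl hfin) |>.2 h1

end Kernels

/-! ### Integrability of series of functions. -/

section Series

theorem integrable_tsum {α : Type*} [MeasurableSpace α] {μ : Measure α} {F : ℕ → α → ℝ}
    (hF : ∀ i, AEStronglyMeasurable (F i) μ) (h : ∑' i, ∫⁻ a, ‖F i a‖ₑ ∂μ ≠ ∞) :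
    Integrable (fun a => ∑' i, F i a) μ := by
  have hlt : ∫⁻ a, ∑' i, ‖F i a‖ₑ ∂μ ≠ ∞ := by
    rwa [lintegral_tsum fun i => (hF i).enorm]
  have hsum : ∀ᵐ a ∂μ, Summable fun i => F i a := by
    filter_upwards [ae_lt_top' (AEMeasurable.tsum fun i => (hF i).enorm) hlt] with a ha
    refine Summable.of_norm ?_
    simpa using ENNReal.summable_toReal ha.ne
  refine ⟨aestronglyMeasurable_of_tendsto_ae Filter.atTop
    (f := fun n a => ∑ i ∈ Finset.range n, F i a)
    (fun n => Finset.aestronglyMeasurable_fun_sum _ fun i _ => hF i) ?_, ?_⟩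
  · filter_upwards [hsum] with a ha using ha.hasSum.tendsto_sum_nat
  · exact (lintegral_mono fun a => enorm_tsum_le_tsum_enorm).trans_lt hlt.lt_top

end Series

/-! ### Stochastic dominance and monotone functions. -/

section Dominance

/-- Layer-cake form of a monotone function, reducing comparison of integrals to comparison of tails.
-/
theorem ofReal_sub_eq_tsum {f : ℕ → ℝ} (hf : Monotone f) (k : ℕ) :
    ENNReal.ofReal (f k - f 0) =
      ∑' y, ENNReal.ofReal (f (y + 1) - f y) * (Set.Ioi y).indicator 1 k := by
  rw [tsum_eq_sum (s := Finset.range k), ← Finset.sum_range_sub,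
    ENNReal.ofReal_sum_of_nonneg fun i _ => sub_nonneg.2 (hf i.le_succ)]
  · refine Finset.sum_congr rfl fun y hy => ?_
    rw [Set.indicator_of_mem (Set.mem_Ioi.2 (Finset.mem_range.1 hy)), Pi.one_apply, mul_one]
  · intro y hy
    rw [Set.indicator_of_notMem (by simpa using hy), mul_zero]

theorem integral_le_of_measure_Ioi_le {μ ν : Measure ℕ} [IsProbabilityMeasure μ]
    [IsProbabilityMeasure ν] (h : ∀ y, μ (Set.Ioi y) ≤ ν (Set.Ioi y)) {f : ℕ → ℝ}
    (hf : Monotone f) (hμ : Integrable f μ) (hν : Integrable f ν) :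
    ∫ y, f y ∂μ ≤ ∫ y, f y ∂ν := by
  have key : ∀ ρ : Measure ℕ, ∫⁻ y, ENNReal.ofReal (f y - f 0) ∂ρ =
      ∑' y, ENNReal.ofReal (f (y + 1) - f y) * ρ (Set.Ioi y) := fun ρ => by
    simp_rw [ofReal_sub_eq_tsum hf]
    rw [lintegral_tsum fun _ => Measurable.of_discrete.aemeasurable]
    simp_rw [lintegral_const_mul _ Measurable.of_discrete,
      lintegral_indicator_one (MeasurableSet.of_discrete)]
  have hle : ∫⁻ y, ENNReal.ofReal (f y - f 0) ∂μ ≤ ∫⁻ y, ENNReal.ofReal (f y - f 0) ∂ν := by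
    rw [key, key]
    exact ENNReal.tsum_le_tsum fun y => mul_le_mul_right (h y) _
  have hnn : ∀ ρ : Measure ℕ, 0 ≤ᵐ[ρ] fun y => f y - f 0 := fun ρ =>
    ae_of_all _ fun y => sub_nonneg.2 (hf (Nat.zero_le y))
  have hμ' : Integrable (fun y => f y - f 0) μ := hμ.sub (integrable_const _)
  have hν' : Integrable (fun y => f y - f 0) ν := hν.sub (integrable_const _)
  rw [← ofReal_integral_eq_lintegral_ofReal hμ' (hnn _),
    ← ofReal_integral_eq_lintegral_ofReal hν' (hnn _),
    ENNReal.ofReal_le_ofReal_iff (integral_nonneg_of_ae (hnn _)),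
    integral_sub hμ (integrable_const _), integral_sub hν (integrable_const _)] at hle
  simpa using hle

end Dominance

/-! ### Real integrals against the Green kernel and Abel summation. -/

section Integrals

variable {P : Kernel ℕ ℕ} {π : Measure ℕ} {f : ℕ → ℝ}

theorem integrable_green_comp {x : ℕ} (hf : Integrable f (green P x)) :
    Integrable f ((green P ∘ₖ killed P) x) := by
  rw [green_eq] at hf
  exact hf.right_of_add_measure

theorem integral_green_eq {x : ℕ} (hf : Integrable f (green P x)) :
    ∫ y, f y ∂green P x = f x + ∫ y, ∫ z, f z ∂green P y ∂killed P x := by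
  have h1 := integrable_green_comp hf
  rw [green_eq] at hf
  rw [green_eq, integral_add_measure hf.left_of_add_measure h1, integral_dirac,
    Kernel.integral_comp h1]

theorem integral_killed {g : ℕ → ℝ} (hg : g 0 = 0) (x : ℕ) :
    ∫ y, g y ∂killed P x = ∫ y, g y ∂P x := by
  rw [killed_apply]
  refine setIntegral_eq_integral_of_forall_compl_eq_zero fun y hy => ?_
  simp only [Set.mem_compl_iff, Set.mem_singleton_iff, not_not] at hy
  rw [hy, hg]

theorem enorm_integral_pow_le [IsProbabilityMeasure π] (hpos : ∀ x, 0 < π {x})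
    (h : Kernel.Invariant P π)
    (f : ℕ → ℝ) (n x : ℕ) :
    ‖∫ y, f y ∂(P ^ n) x‖ₑ ≤ (π {x})⁻¹ * ∫⁻ y, ‖f y‖ₑ ∂π :=
  (enorm_integral_le_lintegral_enorm _).trans (lintegral_pow_le hpos h n x _)

theorem summable_mul_integral_killed_pow {x : ℕ} {g : ℕ → ℝ} (hg : Integrable g (green P x))
    {a : ℝ} (ha : 0 ≤ a) (ha1 : a < 1) :
    Summable fun j => a ^ j * ∫ y, g y ∂(killed P ^ j) x := by
  rw [green_apply] at hg
  have hs := (hasSum_integral_measure hg).summable.norm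
  refine Summable.of_norm_bounded hs fun j => ?_
  rw [norm_mul]
  refine mul_le_of_le_one_left (norm_nonneg _) ?_
  rw [norm_pow, Real.norm_of_nonneg ha]
  exact pow_le_one₀ ha ha1.le

theorem tendsto_tsum_killed {x : ℕ} {g : ℕ → ℝ} (hg : Integrable g (green P x)) :
    Filter.Tendsto (fun a : ℝ => ∑' j, a ^ j * ∫ y, g y ∂(killed P ^ j) x)
      (nhdsWithin 1 (Set.Iio 1)) (nhds (∫ y, g y ∂green P x)) := by
  rw [green_apply] at hg ⊢
  simpa only [mul_comm] using
    Real.tendsto_tsum_powerSeries_nhdsWithin_lt (hasSum_integral_measure hg).tendsto_sum_nat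

end Integrals

/-! ### Poisson's equation for the Green potential. -/

section Poisson

variable {P : Kernel ℕ ℕ} [IsMarkovKernel P] {π : Measure ℕ} [IsProbabilityMeasure π]
  {f : ℕ → ℝ}

theorem integrable_green (hirr : Kernel.IsIrreducible Measure.count P)
    (h : Kernel.Invariant P π) (hG : green P 0 Set.univ ≠ ∞) (hf : Integrable f π) (x : ℕ) :
    Integrable f (green P x) := by
  obtain ⟨c, hc, hle⟩ := exists_green_le hirr h hG x
  exact hf.of_measure_le_smul hc hle

theorem integral_green_zero (hirr : Kernel.IsIrreducible Measure.count P)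
    (h : Kernel.Invariant P π) (hG : green P 0 Set.univ ≠ ∞) (hf0 : ∫ y, f y ∂π = 0) :
    ∫ y, f y ∂green P 0 = 0 := by
  rw [← smul_green_zero_eq hirr h hG, integral_smul_measure] at hf0
  refine (smul_eq_zero.1 hf0).resolve_left ?_
  exact (ENNReal.toReal_pos (invariant_singleton_pos hirr h 0).ne' (measure_ne_top _ _)).ne'

theorem solvesPoisson_green (hirr : Kernel.IsIrreducible Measure.count P)
    (h : Kernel.Invariant P π) (hG : green P 0 Set.univ ≠ ∞) (hf : Integrable f π)
    (hf0 : ∫ y, f y ∂π = 0) : SolvesPoisson P f fun x => ∫ y, f y ∂green P x := by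
  intro x
  have hx := integrable_green hirr h hG hf x
  refine ⟨?_, ?_⟩
  -- Fubini gives integrability off `0`; the atom at `0` is harmless.
  · have h1 : Integrable (fun x => ∫ y, f y ∂green P x) (killed P x) :=
      (integrable_green_comp hx).integral_comp
    rw [killed_apply] at h1
    refine integrableOn_univ.1 ?_
    rw [← Set.compl_union_self {0}]
    exact IntegrableOn.union h1 (integrableOn_singleton (by simp))
  · beta_reduce
    rw [integral_green_eq hx, integral_killed (integral_green_zero hirr h hG hf0)]
    ring

/-- Domination by `π` would need the potential to be `π`-integrable, which is not assumed. Instead,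
each step of `P` raises it by at most its value at `0`. -/
theorem lintegral_pow_green_ne_top {f : ℕ → ℝ≥0∞} (hf : ∀ x, ∫⁻ y, f y ∂green P x ≠ ∞) (n x : ℕ) :
    ∫⁻ y, ∫⁻ z, f z ∂green P y ∂(P ^ n) x ≠ ∞ := by
  induction n with
  | zero => rw [lintegral_pow_zero]; exact hf x
  | succ n ih =>
    rw [lintegral_pow_succ]
    have hle : ∀ y, ∫⁻ w, ∫⁻ z, f z ∂green P w ∂P y ≤
        ∫⁻ z, f z ∂green P y + ∫⁻ z, f z ∂green P 0 := fun y => by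
      rw [lintegral_killed]
      conv_rhs => enter [1]; rw [lintegral_green_left]
      refine add_le_add le_add_self (mul_le_of_le_one_left' prob_le_one)
    refine ne_top_of_le_ne_top ?_ (lintegral_mono hle)
    rw [lintegral_add_left .of_discrete]
    simp [ih, hf 0]

theorem integrable_pow_green (hirr : Kernel.IsIrreducible Measure.count P)
    (h : Kernel.Invariant P π) (hG : green P 0 Set.univ ≠ ∞) (hf : Integrable f π) (n x : ℕ) :
    Integrable (fun x => ∫ y, f y ∂green P x) ((P ^ n) x) := by
  refine ⟨.of_discrete, ?_⟩
  refine (lintegral_mono fun y => enorm_integral_le_lintegral_enorm _).trans_lt ?_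
  exact (lintegral_pow_green_ne_top (fun x => (integrable_green hirr h hG hf x).2.ne) n x).lt_top

end Poisson

/-! ### Discounted potentials and monotonicity. -/

section Monotonicity

variable {P : Kernel ℕ ℕ} {π : Measure ℕ} {f : ℕ → ℝ}

theorem integral_pow_succ {κ : Kernel ℕ ℕ} {n x : ℕ} (hf : Integrable f ((κ ^ (n + 1)) x)) :
    ∫ y, f y ∂(κ ^ (n + 1)) x = ∫ y, ∫ z, f z ∂κ y ∂(κ ^ n) x := by
  rw [pow_succ'] at hf ⊢
  exact Kernel.integral_comp hf

theorem integral_pow_succ' {κ : Kernel ℕ ℕ} {n x : ℕ} (hf : Integrable f ((κ ^ (n + 1)) x)) :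
    ∫ y, f y ∂(κ ^ (n + 1)) x = ∫ y, ∫ z, f z ∂(κ ^ n) y ∂κ x := by
  rw [pow_succ] at hf ⊢
  exact Kernel.integral_comp hf

theorem integral_pow_zero (κ : Kernel ℕ ℕ) (x : ℕ) : ∫ y, f y ∂(κ ^ 0) x = f x := by
  rw [pow_zero]
  change ∫ y, f y ∂(Kernel.id x) = f x
  simp [Kernel.id_apply]

/-- The `a`-discounted potential of `f`. -/
def potential (P : Kernel ℕ ℕ) (f : ℕ → ℝ) (a : ℝ) (x : ℕ) : ℝ :=
  ∑' n, a ^ n * ∫ y, f y ∂(P ^ n) x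

theorem tsum_mul_ne_top {a : ℝ} (ha : 0 ≤ a) (ha1 : a < 1) {u : ℕ → ℝ≥0∞} {C : ℝ≥0∞}
    (hC : C ≠ ∞) (hu : ∀ n, u n ≤ C) : ∑' n, ‖a ^ n‖ₑ * u n ≠ ∞ := by
  refine ne_top_of_le_ne_top ?_ (ENNReal.tsum_le_tsum fun n => mul_le_mul_right (hu n) _)
  rw [ENNReal.tsum_mul_right]
  refine ENNReal.mul_ne_top ?_ hC
  simp_rw [enorm_pow]
  rw [ENNReal.tsum_geometric]
  refine ENNReal.inv_ne_top.2 (tsub_pos_of_lt ?_).ne'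
  rw [Real.enorm_eq_ofReal ha]
  exact ENNReal.ofReal_lt_one.2 ha1

theorem summable_potential [IsProbabilityMeasure π] (hpos : ∀ x, 0 < π {x})
    (h : Kernel.Invariant P π)
    (hf : Integrable f π) {a : ℝ} (ha : 0 ≤ a) (ha1 : a < 1) (x : ℕ) :
    Summable fun n => a ^ n * ∫ y, f y ∂(P ^ n) x := by
  refine Summable.of_norm ?_
  have := tsum_mul_ne_top ha ha1
    (ENNReal.mul_ne_top (ENNReal.inv_ne_top.2 (hpos x).ne') hf.2.ne)
    (fun n => enorm_integral_pow_le hpos h f n x)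
  simp_rw [← enorm_mul] at this
  simpa using ENNReal.summable_toReal this

theorem tsum_lintegral_enorm_potential_ne_top (h : Kernel.Invariant P π) (hf : Integrable f π)
    {a : ℝ} (ha : 0 ≤ a) (ha1 : a < 1) :
    ∑' n, ∫⁻ x, ‖a ^ n * ∫ y, f y ∂(P ^ n) x‖ₑ ∂π ≠ ∞ := by
  simp_rw [enorm_mul, lintegral_const_mul _ Measurable.of_discrete]
  refine tsum_mul_ne_top ha ha1 hf.2.ne fun n => ?_
  rw [← lintegral_invariant h n fun y => ‖f y‖ₑ]
  exact lintegral_mono fun x => enorm_integral_le_lintegral_enorm _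

theorem integrable_potential (h : Kernel.Invariant P π) (hf : Integrable f π) {a : ℝ}
    (ha : 0 ≤ a) (ha1 : a < 1) : Integrable (potential P f a) π :=
  integrable_tsum (fun _ => .of_discrete) (tsum_lintegral_enorm_potential_ne_top h hf ha ha1)

theorem potential_eq [IsProbabilityMeasure π] (hpos : ∀ x, 0 < π {x})
    (h : Kernel.Invariant P π) (hf : Integrable f π)
    {a : ℝ} (ha : 0 ≤ a) (ha1 : a < 1) (x : ℕ) :
    potential P f a x = f x + a * ∫ y, potential P f a y ∂P x := by
  have hfin : ∑' n, ∫⁻ y, ‖a ^ n * ∫ z, f z ∂(P ^ n) y‖ₑ ∂P x ≠ ∞ := by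
    have hle : ∀ u : ℕ → ℝ≥0∞, ∫⁻ y, u y ∂P x ≤ (π {x})⁻¹ * ∫⁻ y, u y ∂π := fun u => by
      simpa using lintegral_pow_le hpos h 1 x u
    refine ne_top_of_le_ne_top ?_ (ENNReal.tsum_le_tsum fun n => hle _)
    rw [ENNReal.tsum_mul_left]
    exact ENNReal.mul_ne_top (ENNReal.inv_ne_top.2 (hpos x).ne')
      (tsum_lintegral_enorm_potential_ne_top h hf ha ha1)
  unfold potential
  rw [integral_tsum (fun _ => .of_discrete) hfin,
    (summable_potential hpos h hf ha ha1 x).tsum_eq_zero_add, integral_pow_zero, ← tsum_mul_left]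
  simp only [pow_zero, one_mul]
  congr 1
  refine tsum_congr fun n => ?_
  rw [integral_pow_succ' (integrable_pow hpos h hf (n + 1) x), integral_const_mul]
  ring

variable [IsMarkovKernel P] [IsProbabilityMeasure π]

theorem monotone_integral_pow (hmono : StochasticallyMonotone P) (hpos : ∀ x, 0 < π {x})
    (h : Kernel.Invariant P π) (hf : Integrable f π) (hfm : Monotone f) (n : ℕ) :
    Monotone fun x => ∫ y, f y ∂(P ^ n) x := by
  induction n with
  | zero => simpa only [integral_pow_zero] using hfm
  | succ n ih =>
    intro x y hxy
    have hi : ∀ x, Integrable (fun y => ∫ z, f z ∂(P ^ n) y) (P x) := fun x => by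
      have := integrable_pow hpos h hf (n + 1) x
      rw [pow_succ] at this
      exact Integrable.integral_comp this
    simp only [integral_pow_succ' (integrable_pow hpos h hf (n + 1) _)]
    exact integral_le_of_measure_Ioi_le (fun z => hmono z hxy) ih (hi x) (hi y)

theorem monotone_potential (hmono : StochasticallyMonotone P) (hpos : ∀ x, 0 < π {x})
    (h : Kernel.Invariant P π) (hf : Integrable f π) (hfm : Monotone f) {a : ℝ} (ha : 0 ≤ a)
    (ha1 : a < 1) : Monotone (potential P f a) := fun x y hxy =>
  (summable_potential hpos h hf ha ha1 x).tsum_le_tsum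
    (fun n => mul_le_mul_of_nonneg_left (monotone_integral_pow hmono hpos h hf hfm n hxy)
      (pow_nonneg ha n)) (summable_potential hpos h hf ha ha1 y)

/-- The discounted potential, normalised to vanish at `0`, as a sum over the killed chain. -/
theorem potential_sub_eq_sum (hpos : ∀ x, 0 < π {x}) (h : Kernel.Invariant P π)
    (hf : Integrable f π) {a : ℝ} (ha : 0 ≤ a) (ha1 : a < 1) (x n : ℕ) :
    potential P f a x - potential P f a 0 =
      ∑ j ∈ Finset.range n,
        a ^ j * ∫ y, (f y - (1 - a) * potential P f a 0) ∂(killed P ^ j) x +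
      a ^ n * ∫ y, (potential P f a y - potential P f a 0) ∂(killed P ^ n) x := by
  have hu := integrable_potential h hf ha ha1
  set u := potential P f a with hu_def
  have hv : Integrable (fun y => u y - u 0) π := hu.sub (integrable_const _)
  have hfc : Integrable (fun y => f y - (1 - a) * u 0) π := hf.sub (integrable_const _)
  have hk : ∀ {g : ℕ → ℝ}, Integrable g π → ∀ n, Integrable g ((killed P ^ n) x) :=
    fun hg n => (integrable_pow hpos h hg n x).mono_measure (killed_pow_le P n x)
  induction n with
  | zero => rw [integral_pow_zero]; simp
  | succ n ih =>
    rw [ih, Finset.sum_range_succ, add_assoc, add_right_inj, pow_succ a, mul_assoc, ← mul_add]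
    congr 1
    -- The resolvent equation, recentred; `u - u 0` vanishes at `0`, so `P` may be replaced by
    -- `killed P`.
    have hstep : ∀ y, u y - u 0 = (f y - (1 - a) * u 0) +
        a * ∫ z, (u z - u 0) ∂killed P y := fun y => by
      have hup : Integrable u (P y) := by simpa using integrable_pow hpos h hu 1 y
      rw [integral_killed (by simp), integral_sub hup (integrable_const _)]
      have := potential_eq hpos h hf ha ha1 y
      rw [← hu_def] at this
      simp only [integral_const, probReal_univ, one_smul]
      linarith
    have hint := hk hv (n + 1)
    rw [integral_pow_succ hint]
    rw [pow_succ'] at hint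
    rw [← integral_const_mul, ← integral_add (hk hfc n)
      ((Integrable.integral_comp hint).const_mul a)]
    exact integral_congr_ae (ae_of_all _ hstep)

/-- The remainder is `a ^ n` times an integral bounded uniformly in `n` through domination by `π`.
-/
theorem potential_sub_eq_tsum (hirr : Kernel.IsIrreducible Measure.count P)
    (h : Kernel.Invariant P π) (hG : green P 0 Set.univ ≠ ∞)
    (hf : Integrable f π) {a : ℝ} (ha : 0 ≤ a) (ha1 : a < 1) (x : ℕ) :
    potential P f a x - potential P f a 0 =
      ∑' j, a ^ j * ∫ y, (f y - (1 - a) * potential P f a 0) ∂(killed P ^ j) x := by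
  have hpos := invariant_singleton_pos hirr h
  have hv : Integrable (fun y => potential P f a y - potential P f a 0) π :=
    (integrable_potential h hf ha ha1).sub (integrable_const _)
  have hfc : Integrable (fun y => f y - (1 - a) * potential P f a 0) π :=
    hf.sub (integrable_const _)
  have h1 := (summable_mul_integral_killed_pow (integrable_green hirr h hG hfc x)
    ha ha1).hasSum.tendsto_sum_nat
  have h2 : Filter.Tendsto (fun n => a ^ n * ∫ y, (potential P f a y - potential P f a 0)
      ∂(killed P ^ n) x) Filter.atTop (nhds 0) := by
    have hb : ∀ n, ‖a ^ n * ∫ y, (potential P f a y - potential P f a 0) ∂(killed P ^ n) x‖ ≤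
        a ^ n * ((π {x})⁻¹ * ∫⁻ y, ‖potential P f a y - potential P f a 0‖ₑ ∂π).toReal := by
      intro n
      rw [norm_mul, norm_pow, Real.norm_of_nonneg ha]
      refine mul_le_mul_of_nonneg_left ?_ (pow_nonneg ha n)
      rw [← toReal_enorm]
      refine ENNReal.toReal_mono
        (ENNReal.mul_ne_top (ENNReal.inv_ne_top.2 (hpos x).ne') hv.2.ne) ?_
      exact (enorm_integral_le_lintegral_enorm _).trans
        ((lintegral_mono' (killed_pow_le P n x) le_rfl).trans (lintegral_pow_le hpos h n x _))
    refine squeeze_zero_norm hb ?_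
    simpa using (tendsto_pow_atTop_nhds_zero_of_lt_one ha ha1).mul_const _
  have h3 := h1.add h2
  simp_rw [← potential_sub_eq_sum hpos h hf ha ha1 x, add_zero] at h3
  exact tendsto_nhds_unique tendsto_const_nhds h3

theorem potential_sub_eq_sub (hirr : Kernel.IsIrreducible Measure.count P)
    (h : Kernel.Invariant P π) (hG : green P 0 Set.univ ≠ ∞)
    (hf : Integrable f π) {a : ℝ} (ha : 0 ≤ a) (ha1 : a < 1) (x : ℕ) :
    potential P f a x - potential P f a 0 =
      ∑' j, a ^ j * ∫ y, f y ∂(killed P ^ j) x -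
      (1 - a) * potential P f a 0 * ∑' j, a ^ j * ∫ _, (1 : ℝ) ∂(killed P ^ j) x := by
  have hpos := invariant_singleton_pos hirr h
  have hk : ∀ {g : ℕ → ℝ}, Integrable g π → ∀ n, Integrable g ((killed P ^ n) x) :=
    fun hg n => (integrable_pow hpos h hg n x).mono_measure (killed_pow_le P n x)
  have h1 : Integrable (fun _ => (1 : ℝ)) π := integrable_const _
  rw [potential_sub_eq_tsum hirr h hG hf ha ha1, ← tsum_mul_left,
    ← (summable_mul_integral_killed_pow (integrable_green hirr h hG hf x) ha ha1).tsum_sub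
      ((summable_mul_integral_killed_pow (integrable_green hirr h hG h1 x) ha ha1).mul_left _)]
  refine tsum_congr fun j => ?_
  have := integral_sub (hk hf j) ((hk h1 j).const_mul ((1 - a) * potential P f a 0))
  rw [integral_const_mul] at this
  simp only [mul_one] at this
  rw [this]
  ring

theorem tendsto_potential_sub (hirr : Kernel.IsIrreducible Measure.count P)
    (h : Kernel.Invariant P π) (hG : green P 0 Set.univ ≠ ∞)
    (hf : Integrable f π) (hf0 : ∫ y, f y ∂π = 0) (x : ℕ) :
    Filter.Tendsto (fun a => potential P f a x - potential P f a 0)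
      (nhdsWithin 1 (Set.Iio 1)) (nhds (∫ y, f y ∂green P x)) := by
  have h1 : Integrable (fun _ => (1 : ℝ)) π := integrable_const _
  have hev : ∀ᶠ a : ℝ in nhdsWithin 1 (Set.Iio 1), a ∈ Set.Ioo (0 : ℝ) 1 :=
    Ioo_mem_nhdsLT one_pos
  have hA := fun x => tendsto_tsum_killed (integrable_green hirr h hG hf x)
  have hT := fun x => tendsto_tsum_killed (integrable_green hirr h hG h1 x)
  have hT0 : ∫ _, (1 : ℝ) ∂green P 0 ≠ 0 := by
    rw [integral_const, smul_eq_mul, mul_one, Measure.real]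
    refine (ENNReal.toReal_pos (fun h0 => ?_) hG).ne'
    have := measure_mono_null (Set.subset_univ {0}) h0
    rw [green_zero_apply_zero] at this
    exact one_ne_zero this
  -- At the state `0` the left side of `potential_sub_eq_sub` is zero, which determines `(1 - a) *
  -- potential P f a 0` as a quotient.
  have hc : Filter.Tendsto (fun a => (1 - a) * potential P f a 0)
      (nhdsWithin 1 (Set.Iio 1)) (nhds 0) := by
    have hq := (hA 0).div (hT 0) hT0
    rw [integral_green_zero hirr h hG hf0, zero_div] at hq
    refine hq.congr' ?_
    filter_upwards [hev, (hT 0).eventually_ne hT0] with a ha hne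
    have := potential_sub_eq_sub hirr h hG hf ha.1.le ha.2 0
    rw [sub_self, eq_comm, sub_eq_zero] at this
    rw [Pi.div_apply, this, mul_div_cancel_right₀ _ hne]
  have hlim := (hA x).sub (hc.mul (hT x))
  rw [zero_mul, sub_zero] at hlim
  refine hlim.congr' ?_
  filter_upwards [hev] with a ha
  exact (potential_sub_eq_sub hirr h hG hf ha.1.le ha.2 x).symm

theorem monotone_integral_green (hirr : Kernel.IsIrreducible Measure.count P)
    (hmono : StochasticallyMonotone P)
    (h : Kernel.Invariant P π) (hG : green P 0 Set.univ ≠ ∞)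
    (hf : Integrable f π) (hfm : Monotone f) (hf0 : ∫ y, f y ∂π = 0) :
    Monotone fun x => ∫ y, f y ∂green P x := by
  intro x y hxy
  have hpos := invariant_singleton_pos hirr h
  refine le_of_tendsto_of_tendsto (tendsto_potential_sub hirr h hG hf hf0 x)
    (tendsto_potential_sub hirr h hG hf hf0 y) ?_
  filter_upwards [Ioo_mem_nhdsLT (one_pos (α := ℝ))] with a ha
  exact sub_le_sub_right (monotone_potential hmono hpos h hf hfm ha.1.le ha.2 hxy) _

end Monotonicity

/-! ### The return time to `0`. -/

section ReturnTime

variable {Ω : Type*} {X : ℕ → Ω → ℕ}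

theorem lt_returnTime_iff (ω : Ω) (n : ℕ) :
    (n : ℕ∞) < returnTime X 0 ω ↔ ∀ i, 1 ≤ i → i ≤ n → X i ω ≠ 0 := by
  constructor
  · intro h i hi hin
    have hlt : (i : ℕ∞) < returnTime X 0 ω := lt_of_le_of_lt (by exact_mod_cast hin) h
    exact notMem_of_lt_hittingAfter hlt hi
  · intro h
    by_contra hle
    rw [not_lt] at hle
    have hne : returnTime X 0 ω ≠ ⊤ := fun h' => by simp [h'] at hle
    have hmem := hittingAfter_mem_set_of_ne_top (u := X) (s := {0}) (n := 1) hne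
    obtain ⟨k, hk⟩ := WithTop.ne_top_iff_exists.1 hne
    have hk' : hittingAfter X {0} 1 ω = (k : WithTop ℕ) := hk.symm
    have h1 := le_hittingAfter (u := X) (s := {0}) (n := 1) ω
    rw [hk'] at hmem h1
    rw [← hk] at hle
    exact h k (WithTop.coe_le_coe.1 h1) (WithTop.coe_le_coe.1 hle) hmem

theorem setOf_lt_returnTime_succ (n : ℕ) :
    {ω | ((n + 1 : ℕ) : ℕ∞) < returnTime X 0 ω} =
      {ω | (n : ℕ∞) < returnTime X 0 ω} ∩ X (n + 1) ⁻¹' {0}ᶜ := by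
  ext ω
  simp only [Set.mem_ofPred_eq, lt_returnTime_iff, Set.mem_inter_iff, Set.mem_preimage,
    Set.mem_compl_iff, Set.mem_singleton_iff]
  refine ⟨fun h => ⟨fun i hi hin => h i hi (by omega), h _ (by omega) le_rfl⟩, fun h i hi hin => ?_⟩
  rcases Nat.lt_or_eq_of_le hin with hlt | rfl
  · exact h.1 i hi (by omega)
  · exact h.2

end ReturnTime

/-! ### From path space to kernels; the martingale. -/

section MarkovChain

variable {Ω : Type*} [MeasurableSpace Ω] {P : Kernel ℕ ℕ} {Pr : ℕ → Measure Ω} {X : ℕ → Ω → ℕ}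

/-- The path up to time `n`. -/
def history (X : ℕ → Ω → ℕ) (n : ℕ) (ω : Ω) : Fin (n + 1) → ℕ := fun i => X i ω

theorem measurable_history (hX : ∀ n, Measurable (X n)) (n : ℕ) : Measurable (history X n) :=
  measurable_pi_lambda _ fun i => hX i

theorem exists_eq_preimage_history {hX : ∀ n, Measurable (X n)} {n : ℕ} {A : Set Ω}
    (hA : MeasurableSet[chainFiltration X hX n] A) : ∃ B, A = history X n ⁻¹' B := by
  have hle : (chainFiltration X hX n : MeasurableSpace Ω) ≤
      MeasurableSpace.comap (history X n) inferInstance := by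
    refine iSup₂_le fun j hj => ?_
    have : X j = (fun h : Fin (n + 1) → ℕ => h ⟨j, Nat.lt_succ_of_le hj⟩) ∘ history X n := rfl
    rw [this, ← MeasurableSpace.comap_comp]
    refine MeasurableSpace.comap_mono ?_
    exact (measurable_pi_apply _).comap_le
  obtain ⟨B, -, hB⟩ := hle A hA
  exact ⟨B, hB.symm⟩

/-- The path space up to time `n` is countable, so the Markov property on single paths determines it
on every past event. -/
theorem measure_inter_succ (hX : IsMarkovFamily P Pr X) (x n y b : ℕ) {A : Set Ω}
    (hA : MeasurableSet[chainFiltration X hX.measurable n] A) :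
    Pr x (A ∩ X n ⁻¹' {y} ∩ X (n + 1) ⁻¹' {b}) = Pr x (A ∩ X n ⁻¹' {y}) * P y {b} := by
  obtain ⟨B, rfl⟩ := exists_eq_preimage_history hA
  have hm := measurable_history hX.measurable n
  have hy : MeasurableSet (X n ⁻¹' {y}) := hX.measurable n (measurableSet_singleton y)
  have hb : MeasurableSet (X (n + 1) ⁻¹' {b}) := hX.measurable _ (measurableSet_singleton b)
  have hB : MeasurableSet B := B.to_countable.measurableSet
  have key : ((Pr x).restrict (X n ⁻¹' {y} ∩ X (n + 1) ⁻¹' {b})).map (history X n) =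
      P y {b} • ((Pr x).restrict (X n ⁻¹' {y})).map (history X n) := by
    refine Measure.ext_of_singleton fun h => ?_
    rw [Measure.smul_apply, Measure.map_apply hm (measurableSet_singleton h),
      Measure.map_apply hm (measurableSet_singleton h),
      Measure.restrict_apply (hm (measurableSet_singleton h)),
      Measure.restrict_apply (hm (measurableSet_singleton h))]
    by_cases hl : h (Fin.last n) = y
    -- Values of `a` beyond `n` never matter; `0` is a filler.
    · let a : ℕ → ℕ := fun i => if hi : i < n + 1 then h ⟨i, hi⟩ else 0
      have ha : history X n ⁻¹' {h} = {ω | ∀ i ≤ n, X i ω = a i} := by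
        ext ω
        simp only [Set.mem_preimage, Set.mem_singleton_iff, Set.mem_ofPred_eq]
        constructor
        · rintro rfl i hi
          have hai : a i = history X n ω ⟨i, Nat.lt_succ_of_le hi⟩ := dif_pos (Nat.lt_succ_of_le hi)
          exact hai.symm
        · intro H
          ext i
          exact (H i (Nat.le_of_lt_succ i.2)).trans (dif_pos i.2)
      have han : a n = y := by simpa [a, Fin.last] using hl
      have hsub : {ω | ∀ i ≤ n, X i ω = a i} ⊆ X n ⁻¹' {y} := fun ω hω => by
        simpa [han] using hω n le_rfl
      have hmk := hX.markov x n a b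
      rw [ha, ← Set.inter_assoc, Set.inter_eq_left.2 hsub, smul_eq_mul, mul_comm, ← han, ← hmk]
      rfl
    · have he : history X n ⁻¹' {h} ∩ X n ⁻¹' {y} = ∅ := by
        ext ω
        simp only [Set.mem_inter_iff, Set.mem_preimage, Set.mem_singleton_iff,
          Set.mem_empty_iff_false, iff_false, not_and]
        rintro rfl h'
        exact hl h'
      rw [← Set.inter_assoc, he]
      simp
  have := congrArg (fun μ => μ B) key
  simp only [Measure.smul_apply, smul_eq_mul] at this
  rw [Measure.map_apply hm hB, Measure.map_apply hm hB, Measure.restrict_apply (hm hB),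
    Measure.restrict_apply (hm hB), ← Set.inter_assoc] at this
  rw [this, mul_comm]

/-- The Markov property, on events of the past. -/
theorem map_succ_restrict (hX : IsMarkovFamily P Pr X) (x n : ℕ) {A : Set Ω}
    (hA : MeasurableSet[chainFiltration X hX.measurable n] A) :
    ((Pr x).restrict A).map (X (n + 1)) = (((Pr x).restrict A).map (X n)).bind P := by
  have hAm : MeasurableSet A := (chainFiltration X hX.measurable).le n A hA
  refine Measure.ext_of_singleton fun b => ?_
  have hb : MeasurableSet (X (n + 1) ⁻¹' {b}) := hX.measurable _ (measurableSet_singleton b)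
  have hy : ∀ y, MeasurableSet (X n ⁻¹' {y}) := fun y =>
    hX.measurable n (measurableSet_singleton y)
  rw [Measure.map_apply (hX.measurable _) (measurableSet_singleton b),
    Measure.bind_apply (measurableSet_singleton b) (Kernel.aemeasurable _), lintegral_countable',
    Measure.restrict_apply hb]
  have h1 : ∀ y, P y {b} * ((Pr x).restrict A).map (X n) {y} =
      ((Pr x).restrict (A ∩ X (n + 1) ⁻¹' {b})).map (X n) {y} := fun y => by
    rw [Measure.map_apply (hX.measurable n) (measurableSet_singleton y),
      Measure.map_apply (hX.measurable n) (measurableSet_singleton y),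
      Measure.restrict_apply (hy y), Measure.restrict_apply (hy y), Set.inter_comm _ A, mul_comm,
      ← measure_inter_succ hX x n y b hA, ← Set.inter_assoc, Set.inter_comm (X n ⁻¹' {y}) A]
  simp_rw [h1]
  have h2 := lintegral_countable' (μ := ((Pr x).restrict (A ∩ X (n + 1) ⁻¹' {b})).map (X n)) 1
  simp only [Pi.one_apply, lintegral_one, one_mul] at h2
  rw [← h2, Measure.map_apply (hX.measurable n) .univ, Set.preimage_univ,
    Measure.restrict_apply_univ, Set.inter_comm]

theorem map_zero (hX : IsMarkovFamily P Pr X) (x : ℕ) : (Pr x).map (X 0) = Measure.dirac x := by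
  have := hX.isProbabilityMeasure x
  rw [Measure.map_congr (hX.initial x), Measure.map_const]
  simp

/-- The law of `X n`. -/
theorem map_eq_pow (hX : IsMarkovFamily P Pr X) (x n : ℕ) : (Pr x).map (X n) = (P ^ n) x := by
  induction n with
  | zero => rw [map_zero hX, pow_zero]; exact (Kernel.id_apply x).symm
  | succ n ih =>
    have := map_succ_restrict hX x n (A := Set.univ) MeasurableSet.univ
    rw [Measure.restrict_univ, ih] at this
    rw [this, pow_succ']
    rfl

theorem measurable_chain {hX : ∀ n, Measurable (X n)} {i n : ℕ} (hin : i ≤ n) :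
    Measurable[chainFiltration X hX n] (X i) :=
  (Filtration.stronglyAdapted_natural fun n => (hX n).stronglyMeasurable).stronglyMeasurable_le hin
    |>.measurable

theorem measurableSet_lt_returnTime (hX : ∀ n, Measurable (X n)) (n : ℕ) :
    MeasurableSet[chainFiltration X hX n] {ω | (n : ℕ∞) < returnTime X 0 ω} := by
  simp_rw [lt_returnTime_iff, Set.ofPred_forall]
  exact .iInter fun i => .iInter fun _ => .iInter fun hin =>
    measurable_chain hin (measurableSet_singleton 0).compl

/-- The law of `X n` on the event that the chain has not yet returned to `0`. -/
theorem map_restrict_lt_returnTime (hX : IsMarkovFamily P Pr X) (x n : ℕ) :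
    ((Pr x).restrict {ω | (n : ℕ∞) < returnTime X 0 ω}).map (X n) = (killed P ^ n) x := by
  induction n with
  | zero =>
    have : {ω | ((0 : ℕ) : ℕ∞) < returnTime X 0 ω} = Set.univ := by
      ext ω
      simp only [Set.mem_ofPred_eq, lt_returnTime_iff, Set.mem_univ, iff_true]
      intro i hi hi0
      omega
    rw [this, Measure.restrict_univ, map_zero hX, pow_zero]
    exact (Kernel.id_apply x).symm
  | succ n ih =>
    have hA := measurableSet_lt_returnTime hX.measurable n
    have h0 : MeasurableSet ({0}ᶜ : Set ℕ) := (measurableSet_singleton 0).compl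
    rw [setOf_lt_returnTime_succ, Set.inter_comm,
      ← Measure.restrict_restrict (hX.measurable (n + 1) h0),
      ← Measure.restrict_map (hX.measurable (n + 1)) h0, map_succ_restrict hX x n hA, ih]
    refine Measure.ext_of_singleton fun b => ?_
    rw [Measure.restrict_apply (measurableSet_singleton b),
      Measure.bind_apply .of_discrete (Kernel.aemeasurable _),
      Kernel.pow_succ_apply_eq_lintegral _ _ _ (measurableSet_singleton b)]
    simp_rw [killed_apply, Measure.restrict_apply (measurableSet_singleton b)]

theorem measure_lt_returnTime (hX : IsMarkovFamily P Pr X) (x n : ℕ) :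
    Pr x {ω | (n : ℕ∞) < returnTime X 0 ω} = (killed P ^ n) x Set.univ := by
  rw [← map_restrict_lt_returnTime hX, Measure.map_apply (hX.measurable n) .univ]
  simp

theorem tsum_lt_le (m : ℕ∞) :
    ∑' n : ℕ, (if (n : ℕ∞) < m then 1 else 0 : ℝ≥0∞) ≤ (m : ℝ≥0∞) := by
  induction m using ENat.recTopCoe with
  | top => simp
  | coe k =>
    rw [tsum_eq_sum (s := Finset.range k) fun n hn => by simpa using hn]
    simp only [Nat.cast_lt]
    rw [Finset.sum_congr rfl fun n hn => if_pos (Finset.mem_range.1 hn)]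
    simp

/-- The mass of `green P 0` is the tail sum `∑ P_0(τ > n)`, bounded by the mean return time. -/
theorem green_zero_univ_ne_top (hX : IsMarkovFamily P Pr X) (hrec : PositiveRecurrent Pr X) :
    green P 0 Set.univ ≠ ∞ := by
  refine ne_top_of_le_ne_top (hrec 0).ne ?_
  refine le_trans ?_ (lintegral_mono fun ω => tsum_lt_le (returnTime X 0 ω))
  have hms : ∀ n : ℕ, MeasurableSet {ω | (n : ℕ∞) < returnTime X 0 ω} := fun n =>
    (chainFiltration X hX.measurable).le n _ (measurableSet_lt_returnTime hX.measurable n)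
  rw [lintegral_tsum fun n => (Measurable.ite (hms n) measurable_const
    measurable_const).aemeasurable, green_apply, Measure.sum_apply _ .univ]
  refine ENNReal.tsum_le_tsum fun n => ?_
  rw [← measure_lt_returnTime hX, ← lintegral_indicator_one (hms n)]
  exact le_of_eq (lintegral_congr fun ω => by simp [Set.indicator_apply])

/-- The event `τ = ∞` lies in every `{τ > n}`, and these have summable probabilities. -/
theorem ae_returnTime_lt_top (hX : IsMarkovFamily P Pr X) {x : ℕ}
    (hG : green P x Set.univ ≠ ∞) : ∀ᵐ ω ∂Pr x, returnTime X 0 ω < ⊤ := by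
  rw [green_apply, Measure.sum_apply _ .univ] at hG
  have h0 := ENNReal.tendsto_atTop_zero_of_tsum_ne_top hG
  refine le_antisymm (ge_of_tendsto' h0 fun n => ?_) zero_le
  rw [← measure_lt_returnTime hX]
  refine measure_mono fun ω hω => ?_
  simp only [Set.mem_compl_iff, Set.mem_ofPred_eq, not_lt, top_le_iff] at hω
  simp [hω]

/-- Bridge from paths to kernels: exchange sum and expectation, then use the law of `X n` on `{n <
τ}`. -/
theorem integrable_cycleSum_and_integral (hX : IsMarkovFamily P Pr X) {f : ℕ → ℝ} {x : ℕ}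
    (hf : Integrable f (green P x)) : Integrable (cycleSum X f) (Pr x) ∧
      ∫ ω, cycleSum X f ω ∂Pr x = ∫ y, f y ∂green P x := by
  classical
  let F : ℕ → Ω → ℝ := fun n => {ω | (n : ℕ∞) < returnTime X 0 ω}.indicator fun ω => f (X n ω)
  have hcs : cycleSum X f = fun ω => ∑' n, F n ω := by
    ext ω
    refine tsum_congr fun n => ?_
    simp [F, Set.indicator_apply]
  have hms : ∀ n : ℕ, MeasurableSet {ω | (n : ℕ∞) < returnTime X 0 ω} := fun n =>
    (chainFiltration X hX.measurable).le n _ (measurableSet_lt_returnTime hX.measurable n)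
  have hfX : ∀ n, Measurable fun ω => f (X n ω) := fun n =>
    (Measurable.of_discrete (f := f)).comp (hX.measurable n)
  have hF : ∀ n, AEStronglyMeasurable (F n) (Pr x) := fun n =>
    ((hfX n).indicator (hms n)).aestronglyMeasurable
  have hnorm : ∀ n, ∫⁻ ω, ‖F n ω‖ₑ ∂Pr x = ∫⁻ y, ‖f y‖ₑ ∂(killed P ^ n) x := fun n => by
    rw [← map_restrict_lt_returnTime hX, lintegral_map .of_discrete (hX.measurable n),
      ← lintegral_indicator (hms n)]
    exact lintegral_congr fun ω => by simp [F, enorm_indicator_eq_indicator_enorm]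
  have hint : ∀ n, ∫ ω, F n ω ∂Pr x = ∫ y, f y ∂(killed P ^ n) x := fun n => by
    rw [← map_restrict_lt_returnTime hX, integral_map (hX.measurable n).aemeasurable .of_discrete,
      ← integral_indicator (hms n)]
  have hfin : ∑' n, ∫⁻ ω, ‖F n ω‖ₑ ∂Pr x ≠ ∞ := by
    simp_rw [hnorm]
    rw [← lintegral_green]
    exact hf.2.ne
  rw [hcs]
  refine ⟨integrable_tsum hF hfin, ?_⟩
  rw [integral_tsum hF hfin]
  simp_rw [hint]
  rw [green_apply] at hf ⊢
  exact (integral_sum_measure hf).symm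

theorem integrable_comp_chain (hX : IsMarkovFamily P Pr X) {f : ℕ → ℝ} {x n : ℕ}
    (hf : Integrable f ((P ^ n) x)) : Integrable (fun ω => f (X n ω)) (Pr x) := by
  rw [← map_eq_pow hX] at hf
  exact hf.comp_measurable (hX.measurable n)

theorem martingale_of_solvesPoisson (hX : IsMarkovFamily P Pr X) {f g : ℕ → ℝ}
    (hg : SolvesPoisson P f g) {x : ℕ} (hfi : ∀ n, Integrable f ((P ^ n) x))
    (hgi : ∀ n, Integrable g ((P ^ n) x)) :
    Martingale (fun n ω => g (X n ω) + ∑ j ∈ Finset.range n, f (X j ω))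
      (chainFiltration X hX.measurable) (Pr x) := by
  have := hX.isProbabilityMeasure x
  have hfX := fun n => integrable_comp_chain hX (hfi n)
  have hgX := fun n => integrable_comp_chain hX (hgi n)
  have hsum := fun n => integrable_finsetSum (Finset.range n) fun j _ => hfX j
  refine martingale_of_setIntegral_eq_succ (fun n => Measurable.stronglyMeasurable ?_)
    (fun n => (hgX n).add (hsum n)) fun n A hA => ?_
  · refine Measurable.add ((Measurable.of_discrete (f := g)).comp (measurable_chain le_rfl))
      (Finset.measurable_fun_sum _ fun j hj => (Measurable.of_discrete (f := f)).comp
        (measurable_chain (Finset.mem_range.1 hj).le))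
  · have hmap := map_succ_restrict hX x n hA
    have hgA : Integrable g (((Pr x).restrict A).map (X (n + 1))) :=
      (integrable_map_measure .of_discrete (hX.measurable _).aemeasurable).2
        (hgX (n + 1)).restrict
    -- The Markov property on `A` turns `g (X (n + 1))` into `P g (X n)`, which is `g - f` at `X n`
    -- by Poisson's equation.
    have h1 : ∫ ω in A, g (X (n + 1) ω) ∂Pr x = ∫ ω in A, (g (X n ω) - f (X n ω)) ∂Pr x := by
      rw [← integral_map (hX.measurable _).aemeasurable .of_discrete, hmap,
        Measure.comp_eq_comp_const_apply, Kernel.integral_comp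
          (by rwa [hmap, Measure.comp_eq_comp_const_apply] at hgA), Kernel.const_apply,
        integral_map (hX.measurable _).aemeasurable .of_discrete]
      refine integral_congr_ae (ae_of_all _ fun ω => ?_)
      have := (hg (X n ω)).2
      beta_reduce
      linarith
    have hadd := integral_add (μ := (Pr x).restrict A) (hsum n).restrict (hfX n).restrict
    simp_rw [← Finset.sum_range_succ] at hadd
    rw [integral_add (hgX n).restrict (hsum n).restrict,
      integral_add (hgX (n + 1)).restrict (hsum (n + 1)).restrict, h1,
      integral_sub (hgX n).restrict (hfX n).restrict,
      hadd]
    ring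

end MarkovChain

end MonotoneChain

end

theorem theorem1 {Ω : Type*} [MeasurableSpace Ω]
    (P : Kernel ℕ ℕ) [IsMarkovKernel P]
    (Pr : ℕ → Measure Ω) (X : ℕ → Ω → ℕ)
    (hX : MonotoneChain.IsMarkovFamily P Pr X)
    (hirr : Kernel.IsIrreducible Measure.count P)
    (hrec : MonotoneChain.PositiveRecurrent Pr X)
    (hmono : MonotoneChain.StochasticallyMonotone P)
    (π : Measure ℕ) [IsProbabilityMeasure π] (hπ : Kernel.Invariant P π)
    (r : ℕ → ℝ) (hr : Integrable r π) (hr_mono : Monotone r) :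
    -- `g₀` is well defined: under each `Pr x`, `τ` is a.s. finite and the sum is integrable
    (∀ x, (∀ᵐ ω ∂(Pr x), MonotoneChain.returnTime X 0 ω < ⊤) ∧
      Integrable (MonotoneChain.cycleSum X (MonotoneChain.centered π r)) (Pr x)) ∧
    Monotone (MonotoneChain.g₀ Pr X π r) ∧
    MonotoneChain.SolvesPoisson P (MonotoneChain.centered π r) (MonotoneChain.g₀ Pr X π r) ∧
    ∀ x, Martingale
      (fun n ω => MonotoneChain.g₀ Pr X π r (X n ω) +
        ∑ j ∈ Finset.range n, MonotoneChain.centered π r (X j ω))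
      (MonotoneChain.chainFiltration X hX.measurable) (Pr x) := by
  open MonotoneChain in
  have hG := green_zero_univ_ne_top hX hrec
  have hpos := invariant_singleton_pos hirr hπ
  have hf : Integrable (centered π r) π := hr.sub (integrable_const _)
  have hf0 : ∫ y, centered π r y ∂π = 0 := by
    unfold centered
    rw [integral_sub hr (integrable_const _)]
    simp
  have hfm : Monotone (centered π r) := fun x y hxy => sub_le_sub_right (hr_mono hxy) _
  have hcyc := fun x => integrable_cycleSum_and_integral hX (integrable_green hirr hπ hG hf x)
  have hg : g₀ Pr X π r = fun x => ∫ y, centered π r y ∂green P x := funext fun x => (hcyc x).2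
  have hfin : ∀ x, green P x Set.univ ≠ ∞ := fun x => by
    obtain ⟨c, hc, hle⟩ := exists_green_le hirr hπ hG x
    exact ne_top_of_le_ne_top (by simpa using hc) (hle Set.univ)
  have hsol := solvesPoisson_green hirr hπ hG hf hf0
  rw [hg]
  exact ⟨fun x => ⟨ae_returnTime_lt_top hX (hfin x), (hcyc x).1⟩,
    monotone_integral_green hirr hmono hπ hG hf hfm hf0, hsol,
    fun x => martingale_of_solvesPoisson hX hsol (fun n => integrable_pow hpos hπ hf n x)
      (fun n => integrable_pow_green hirr hπ hG hf n x)⟩
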